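/- Let $d\ge 1$ and let $\psi:\mathbb{R}^d\to[0,1]$ be measurable, symmetric ($\psi(x)=\psi(-x)$), and zero outside the closed Euclidean unit ball around the origin $o$. Fix a measurable strict total order $<$ on $\mathbb{R}^d$ (for instance the lexicographic order). For $\lambda>0$ let $X_0,X_1,\dots$ be an enumeration of a homogeneous Poisson point process $\mathcal P_\lambda$ on $\mathbb{R}^d$ of intensity $\lambda$, let $U_{i,j}$ and $U_{-1,j}$ ($i,j\ge 0$) be independent uniform random variables on $[0,1]$, independent of $(X_i)_i$, and let $\xi_\lambda^o$ be the random graph with vertex set $\mathcal P_\lambda\cup\{o\}$ in which $X_i$ and $X_j$ with $X_i<X_j$ are joined by an edge if and only if $U_{i,j}\le\psi(X_i-X_j)$, and $o$ and $X_j$ are joined by an edge if and only if $U_{-1,j}\le\psi(o-X_j)$. Let the percolation probability $\theta(\lambda)$ be the probability that, for every $t>0$, the vertex $o$ is connected by a finite path of $\xi_\lambda^o$ to a vertex outside $[-t/2,t/2]^d$. Then $\theta$ is right-continuous on $(0,\infty)$: for every $\lambda>0$, $\theta(\lambda')\to\theta(\lambda)$ as $\lambda'\downarrow\lambda$. -/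

import Mathlib

open MeasureTheory ProbabilityTheory Set
open scoped ENNReal NNReal

/-- A connection function on `ℝ^d`: measurable, with values in `[0,1]`, symmetric, and vanishing
outside the closed Euclidean unit ball. -/
structure IsConnectionFunction {d : ℕ} (ψ : EuclideanSpace ℝ (Fin d) → ℝ) : Prop where
  measurable : Measurable ψ
  mem_Icc : ∀ x, ψ x ∈ Icc (0 : ℝ) 1
  symm : ∀ x, ψ (-x) = ψ x
  support_subset : Function.support ψ ⊆ Metric.closedBall 0 1

/-- The number of points of the sequence `X 0 ω, X 1 ω, …` that lie in `B`. -/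
noncomputable def pointCount {d : ℕ} {Ω : Type*} (X : ℕ → Ω → EuclideanSpace ℝ (Fin d))
    (B : Set (EuclideanSpace ℝ (Fin d))) (ω : Ω) : ℕ∞ :=
  {i : ℕ | X i ω ∈ B}.encard

/-- The random points `X 0, X 1, …` enumerate a homogeneous Poisson point process on `ℝ^d` of
intensity `l`: the number of points in a Borel set of finite volume `v` is Poisson distributed with
parameter `l * v`, and the numbers of points in pairwise disjoint Borel sets are independent. -/
structure IsPoissonProcess {d : ℕ} {Ω : Type*} [MeasurableSpace Ω] (l : ℝ) (P : Measure Ω)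
    (X : ℕ → Ω → EuclideanSpace ℝ (Fin d)) : Prop where
  measurable : ∀ i, Measurable (X i)
  hasLaw : ∀ B : Set (EuclideanSpace ℝ (Fin d)), MeasurableSet B → volume B ≠ ∞ →
    HasLaw (pointCount X B)
      ((poissonMeasure (ENNReal.ofReal l * volume B).toNNReal).map (Nat.cast : ℕ → ℕ∞)) P
  indep : ∀ (n : ℕ) (B : Fin n → Set (EuclideanSpace ℝ (Fin d))), (∀ k, MeasurableSet (B k)) →
    Pairwise (fun j k => Disjoint (B j) (B k)) → iIndepFun (fun k => pointCount X (B k)) P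

/-- The data of the random connection model of intensity `l` with an additional point at the
origin: an enumerated Poisson process `X` of intensity `l`, and edge marks `U` that are independent,
uniformly distributed on `[0,1]`, and independent of `X`. The mark `U (some i) j` belongs to the
pair `X i, X j`, and `U none j` belongs to the pair consisting of the origin and `X j`. -/
structure IsIndependentEdgeMarking {d : ℕ} {Ω : Type*} [MeasurableSpace Ω] (l : ℝ) (P : Measure Ω)
    (X : ℕ → Ω → EuclideanSpace ℝ (Fin d)) (U : Option ℕ → ℕ → Ω → ℝ) : Prop where
  poisson : IsPoissonProcess l P X
  measurable_mark : ∀ a j, Measurable (U a j)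
  uniform_mark : ∀ a j, HasLaw (U a j) (volume.restrict (Icc (0 : ℝ) 1)) P
  indep_mark : iIndepFun (fun p : Option ℕ × ℕ => U p.1 p.2) P
  indep_points_marks :
    IndepFun (fun ω (i : ℕ) => X i ω) (fun ω (p : Option ℕ × ℕ) => U p.1 p.2 ω) P

/-- The position of a vertex: `none` is the additional point at the origin, `some i` is the `i`-th
point of the process. -/
def vertexPos {d : ℕ} {Ω : Type*} (X : ℕ → Ω → EuclideanSpace ℝ (Fin d)) (ω : Ω) :
    Option ℕ → EuclideanSpace ℝ (Fin d)
  | none => 0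
  | some i => X i ω

/-- The relation "`a` precedes `b`, and the mark of the pair is at most `ψ` of the difference of
the positions". The additional point at the origin precedes all other points, and the points of the
process are ordered by `r`. -/
def markedEdge {d : ℕ} {Ω : Type*}
    (r : EuclideanSpace ℝ (Fin d) → EuclideanSpace ℝ (Fin d) → Prop)
    (ψ : EuclideanSpace ℝ (Fin d) → ℝ) (X : ℕ → Ω → EuclideanSpace ℝ (Fin d))
    (U : Option ℕ → ℕ → Ω → ℝ) (ω : Ω) : Option ℕ → Option ℕ → Prop
  | none, some j => U none j ω ≤ ψ (0 - X j ω)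
  | some i, some j => r (X i ω) (X j ω) ∧ U (some i) j ω ≤ ψ (X i ω - X j ω)
  | _, none => False

/-- The random connection model with an additional point at the origin, as a random graph. -/
def rcmGraph {d : ℕ} {Ω : Type*}
    (r : EuclideanSpace ℝ (Fin d) → EuclideanSpace ℝ (Fin d) → Prop)
    (ψ : EuclideanSpace ℝ (Fin d) → ℝ) (X : ℕ → Ω → EuclideanSpace ℝ (Fin d))
    (U : Option ℕ → ℕ → Ω → ℝ) (ω : Ω) : SimpleGraph (Option ℕ) :=
  SimpleGraph.fromRel (markedEdge r ψ X U ω)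

/-- The box `[-t/2, t/2]^d`. -/
def centeredBox (d : ℕ) (t : ℝ) : Set (EuclideanSpace ℝ (Fin d)) :=
  {x | ∀ k, x k ∈ Icc (-(t / 2)) (t / 2)}

/-- The event that the origin is connected to the complement of the box of side length `t`. -/
def connectsOutside {d : ℕ} {Ω : Type*}
    (r : EuclideanSpace ℝ (Fin d) → EuclideanSpace ℝ (Fin d) → Prop)
    (ψ : EuclideanSpace ℝ (Fin d) → ℝ) (X : ℕ → Ω → EuclideanSpace ℝ (Fin d))
    (U : Option ℕ → ℕ → Ω → ℝ) (t : ℝ) : Set Ω :=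
  {ω | ∃ v, vertexPos X ω v ∈ (centeredBox d t)ᶜ ∧ (rcmGraph r ψ X U ω).Reachable none v}

/-- The percolation event: for every `t > 0`, the origin is connected to the complement of the box
of side length `t`. -/
def percolationEvent {d : ℕ} {Ω : Type*}
    (r : EuclideanSpace ℝ (Fin d) → EuclideanSpace ℝ (Fin d) → Prop)
    (ψ : EuclideanSpace ℝ (Fin d) → ℝ) (X : ℕ → Ω → EuclideanSpace ℝ (Fin d))
    (U : Option ℕ → ℕ → Ω → ℝ) : Set Ω :=
  ⋂ (t : ℝ) (_ : 0 < t), connectsOutside r ψ X U t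

/-- The percolation probability. -/
noncomputable def percolationProbability {d : ℕ} {Ω : Type*} [MeasurableSpace Ω]
    (r : EuclideanSpace ℝ (Fin d) → EuclideanSpace ℝ (Fin d) → Prop)
    (ψ : EuclideanSpace ℝ (Fin d) → ℝ) (P : Measure Ω)
    (X : ℕ → Ω → EuclideanSpace ℝ (Fin d)) (U : Option ℕ → ℕ → Ω → ℝ) : ℝ :=
  P.real (percolationEvent r ψ X U)

/-! The percolation event is the decreasing limit of the events that the origin is connected to the
outside of a box, so `θ` is the infimum of the probabilities of these events. It suffices that each
of them is nondecreasing and continuous from the right in the intensity. Then `θ` is nondecreasing,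
which bounds it from below on the right of `λ`, and it is an infimum of upper semicontinuous
functions, which bounds it from above.

Almost surely edges have length at most one, so a path followed up to its first exit from the box of
side `t` stays in the box `B` of side `t + 2` (`exits_iff_exits_restrict`). Given that `B` contains
`n` points, these are independent and uniform and carry independent uniform marks. The connection
probability is therefore `E p(N)`, with `N` Poisson of mean `λ|B|` and `p = meanExitProb r ψ t` free
of `λ`, bounded by one, and nondecreasing because an extra vertex destroys no path
(`IsIndependentEdgeMarking.measure_connectsOutside`). Raising the intensity adds an independent
Poisson variable to `N`: the mean does not decrease (`lintegral_poissonMeasure_mono`) and grows by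
at most the added parameter (`lintegral_poissonMeasure_add_le`). This comparison concerns laws only,
so the models of different intensities need no common probability space.

The Poisson hypothesis speaks of counts and the enumeration is arbitrary. The law of the points in
`B` is recovered in `orderedPoints_eq`, by summing over all orderings of these points. -/

/-! ### Poisson means as functions of the parameter. -/

theorem lintegral_poissonMeasure_add (p : ℕ → ℝ≥0∞) (r s : ℝ≥0) :
    ∫⁻ n, p n ∂(poissonMeasure (r + s)) =
      ∫⁻ m, ∫⁻ n, p (m + n) ∂(poissonMeasure s) ∂(poissonMeasure r) := by
  rw [← poissonMeasure_conv_poissonMeasure, Measure.lintegral_conv (by fun_prop)]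

theorem lintegral_poissonMeasure_mono {p : ℕ → ℝ≥0∞} (hp : Monotone p) {r s : ℝ≥0} (h : r ≤ s) :
    ∫⁻ n, p n ∂(poissonMeasure r) ≤ ∫⁻ n, p n ∂(poissonMeasure s) := by
  obtain ⟨δ, rfl⟩ := exists_add_of_le h
  rw [lintegral_poissonMeasure_add]
  refine lintegral_mono fun m => ?_
  calc p m = ∫⁻ _, p m ∂(poissonMeasure δ) := by simp
    _ ≤ _ := lintegral_mono fun n => hp (Nat.le_add_right m n)

theorem poissonMeasure_compl_zero_le (δ : ℝ≥0) : poissonMeasure δ {0}ᶜ ≤ δ := by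
  rw [prob_compl_eq_one_sub (by measurability), poissonMeasure_singleton]
  simp only [pow_zero, mul_one, Nat.factorial_zero, Nat.cast_one, div_one]
  rw [← ENNReal.ofReal_one, ← ENNReal.ofReal_sub _ (Real.exp_pos _).le,
    ← ENNReal.ofReal_coe_nnreal]
  apply ENNReal.ofReal_le_ofReal
  have := Real.add_one_le_exp (-(δ : ℝ))
  linarith

/-- The added Poisson variable changes the value only if it is nonzero, which has probability `1 -
exp (-δ) ≤ δ`, and then `p` is at most one. -/
theorem lintegral_poissonMeasure_add_le {p : ℕ → ℝ≥0∞} (hp : ∀ n, p n ≤ 1) (r δ : ℝ≥0) :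
    ∫⁻ n, p n ∂(poissonMeasure (r + δ)) ≤ ∫⁻ n, p n ∂(poissonMeasure r) + δ := by
  rw [lintegral_poissonMeasure_add]
  have key : ∀ m, ∫⁻ n, p (m + n) ∂(poissonMeasure δ) ≤ p m + δ := by
    intro m
    calc ∫⁻ n, p (m + n) ∂(poissonMeasure δ)
        ≤ ∫⁻ n, (p m + ({0}ᶜ : Set ℕ).indicator 1 n) ∂(poissonMeasure δ) := by
          refine lintegral_mono fun n => ?_
          rcases eq_or_ne n 0 with rfl | hn
          · simp
          · simpa [hn] using (hp _).trans le_add_self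
      _ = p m + poissonMeasure δ {0}ᶜ := by
          rw [lintegral_add_left (by fun_prop), lintegral_indicator_one (by measurability)]
          simp
      _ ≤ _ := by gcongr; exact poissonMeasure_compl_zero_le δ
  calc _ ≤ ∫⁻ m, (p m + δ) ∂(poissonMeasure r) := lintegral_mono key
    _ = _ := by rw [lintegral_add_left (by fun_prop)]; simp

/-! ### The joint law of the points in a set of finite volume. -/

/-- The event that the points of the sequence lying in `B` are exactly those with index in the
range of `σ`. -/
def pointsExactlyAt {d n : ℕ} {Ω : Type*} (X : ℕ → Ω → EuclideanSpace ℝ (Fin d))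
    (B : Set (EuclideanSpace ℝ (Fin d))) (σ : Fin n ↪ ℕ) : Set Ω :=
  {ω | ∀ i, X i ω ∈ B ↔ i ∈ range σ}

/-- The sum, over all orderings of the points in `B`, of the law of the ordered vector of points,
restricted to the event that `B` contains exactly `n` points. -/
noncomputable def orderedPoints {d : ℕ} {Ω : Type*} [MeasurableSpace Ω]
    (X : ℕ → Ω → EuclideanSpace ℝ (Fin d)) (P : Measure Ω) (B : Set (EuclideanSpace ℝ (Fin d)))
    (n : ℕ) : Measure (Fin n → EuclideanSpace ℝ (Fin d)) :=
  Measure.sum fun σ : Fin n ↪ ℕ =>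
    (P.restrict (pointsExactlyAt X B σ)).map (fun ω k => X (σ k) ω)

instance countable_fin_embedding_nat (n : ℕ) : Countable (Fin n ↪ ℕ) :=
  DFunLike.coe_injective.countable

section
variable {d : ℕ} {Ω : Type*} [MeasurableSpace Ω] {l : ℝ} {P : Measure Ω}
  {X : ℕ → Ω → EuclideanSpace ℝ (Fin d)} {B : Set (EuclideanSpace ℝ (Fin d))} {n : ℕ}

theorem measurableSet_pointsExactlyAt (hX : ∀ i, Measurable (X i)) (hB : MeasurableSet B)
    (σ : Fin n ↪ ℕ) : MeasurableSet (pointsExactlyAt X B σ) := by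
  rw [pointsExactlyAt, ofPred_forall]
  exact MeasurableSet.iInter fun i => (hX i hB).iff (MeasurableSet.const _)

theorem measurableSet_pointsExactlyAt_inter (hX : ∀ i, Measurable (X i)) (hB : MeasurableSet B)
    (σ : Fin n ↪ ℕ) {S : Set (Fin n → EuclideanSpace ℝ (Fin d))} (hS : MeasurableSet S) :
    MeasurableSet (pointsExactlyAt X B σ ∩ {ω | (fun k => X (σ k) ω) ∈ S}) :=
  (measurableSet_pointsExactlyAt hX hB σ).inter
    (measurableSet_preimage (measurable_pi_lambda _ fun k => hX (σ k)) hS)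

theorem orderedPoints_apply (hX : ∀ i, Measurable (X i))
    {S : Set (Fin n → EuclideanSpace ℝ (Fin d))} (hS : MeasurableSet S) :
    orderedPoints X P B n S =
      ∑' σ : Fin n ↪ ℕ, P (pointsExactlyAt X B σ ∩ {ω | (fun k => X (σ k) ω) ∈ S}) := by
  rw [orderedPoints, Measure.sum_apply _ hS]
  refine tsum_congr fun σ => ?_
  have hm : Measurable fun ω k => X (σ k) ω := measurable_pi_lambda _ fun k => hX (σ k)
  rw [Measure.map_apply hm hS, Measure.restrict_apply (hm hS), inter_comm]
  rfl

theorem IsPoissonProcess.measure_pointCount_eq (h : IsPoissonProcess l P X) (hB : MeasurableSet B)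
    (hB' : volume B ≠ ∞) (k : ℕ) :
    P {ω | pointCount X B ω = k} = poissonMeasure (ENNReal.ofReal l * volume B).toNNReal {k} := by
  rw [(h.hasLaw B hB hB').measure_eq (p := fun x => x = k) (measurableSet_singleton _),
    Measure.map_apply .of_discrete .of_discrete]
  congr 1
  ext j
  simp

theorem IsPoissonProcess.ae_pointCount_ne_top (h : IsPoissonProcess l P X) (hB : MeasurableSet B)
    (hB' : volume B ≠ ∞) : ∀ᵐ ω ∂P, pointCount X B ω ≠ ⊤ := by
  rw [ae_iff]
  simp only [ne_eq, not_not]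
  rw [(h.hasLaw B hB hB').measure_eq (p := fun x => x = ⊤) (measurableSet_singleton _),
    Measure.map_apply .of_discrete .of_discrete]
  convert measure_empty (μ := poissonMeasure (ENNReal.ofReal l * volume B).toNNReal)
  ext j
  simp

/-- For disjoint sides, some ordering of the points of `B` lies in the rectangle exactly when each
side holds one point and the rest of `B` none. This is an event about counts, which is all that
`IsPoissonProcess` controls. -/
theorem iUnion_pointsExactlyAt_inter_pi {Ω : Type*} {X : ℕ → Ω → EuclideanSpace ℝ (Fin d)}
    {C : Fin n → Set (EuclideanSpace ℝ (Fin d))}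
    (hCB : ∀ k, C k ⊆ B) (hC : Pairwise fun j k => Disjoint (C j) (C k)) :
    ⋃ σ : Fin n ↪ ℕ, pointsExactlyAt X B σ ∩ {ω | (fun k => X (σ k) ω) ∈ pi univ C} =
      ⋂ j ∈ (Finset.univ : Finset (Fin (n + 1))),
        pointCount X (Fin.cons (α := fun _ => Set (EuclideanSpace ℝ (Fin d))) (B \ ⋃ k, C k) C j) ⁻¹'
          {Fin.cons (α := fun _ => ℕ∞) 0 (fun _ => 1) j} := by
  ext ω
  simp only [mem_iUnion, mem_inter_iff, mem_ofPred_eq, Finset.mem_univ, iInter_true, mem_iInter,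
    mem_preimage, mem_singleton_iff, Fin.forall_fin_succ, Fin.cons_zero, Fin.cons_succ, mem_pi,
    mem_univ, true_imp_iff, pointsExactlyAt, pointCount, encard_eq_zero, encard_eq_one]
  constructor
  · rintro ⟨σ, hσ, hσC⟩
    refine ⟨?_, fun k => ⟨σ k, ?_⟩⟩
    · rw [eq_empty_iff_forall_notMem]
      rintro i ⟨hi, hi'⟩
      obtain ⟨k, rfl⟩ := (hσ i).1 hi
      exact hi' (mem_iUnion_of_mem k (hσC k))
    · ext i
      simp only [mem_ofPred_eq, mem_singleton_iff]
      refine ⟨fun hi => ?_, fun hi => hi ▸ hσC k⟩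
      obtain ⟨j, rfl⟩ := (hσ i).1 (hCB k hi)
      by_contra hne
      exact disjoint_left.1 (hC fun hjk : j = k => hne (hjk ▸ rfl)) (hσC j) hi
  · rintro ⟨h0, h1⟩
    choose σ hσ using h1
    have hmem : ∀ k, X (σ k) ω ∈ C k := fun k => by
      have : σ k ∈ {i | X i ω ∈ C k} := by rw [hσ k]; rfl
      exact this
    refine ⟨⟨σ, fun j k hjk => ?_⟩, fun i => ⟨fun hi => ?_, ?_⟩, hmem⟩
    · by_contra hne
      exact disjoint_left.1 (hC hne) (hmem j) (hjk ▸ hmem k)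
    · by_contra hne
      have : i ∈ {i | X i ω ∈ B \ ⋃ k, C k} := by
        refine ⟨hi, fun hi' => ?_⟩
        obtain ⟨k, hk⟩ := mem_iUnion.1 hi'
        have : i ∈ {i | X i ω ∈ C k} := hk
        rw [hσ k] at this
        exact hne ⟨k, this.symm⟩
      rw [h0] at this
      exact this
    · rintro ⟨k, rfl⟩
      exact hCB k (hmem k)

/-- The index `σ k` is forced, being that of the only point in `C k`; hence the sum over orderings
is the measure of a union. -/
theorem pairwise_disjoint_pointsExactlyAt_inter_pi {Ω : Type*}
    {X : ℕ → Ω → EuclideanSpace ℝ (Fin d)} {C : Fin n → Set (EuclideanSpace ℝ (Fin d))}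
    (hC : Pairwise fun j k => Disjoint (C j) (C k)) :
    Pairwise (Function.onFun Disjoint fun σ : Fin n ↪ ℕ =>
      pointsExactlyAt X B σ ∩ {ω | (fun k => X (σ k) ω) ∈ pi univ C}) := by
  intro σ τ hne
  refine disjoint_left.2 ?_
  rintro ω ⟨hσ, hσC⟩ ⟨hτ, hτC⟩
  refine hne (DFunLike.ext _ _ fun k => ?_)
  obtain ⟨j, hj⟩ := (hτ (σ k)).1 ((hσ _).2 ⟨k, rfl⟩)
  rw [← hj]
  congr 1
  by_contra hjk
  exact disjoint_left.1 (hC hjk) (hτC j trivial) (by simpa [hj] using hσC k trivial)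

theorem orderedPoints_pi_of_disjoint [IsProbabilityMeasure P] (h : IsPoissonProcess l P X)
    (hB : MeasurableSet B) (hB' : volume B ≠ ∞) {C : Fin n → Set (EuclideanSpace ℝ (Fin d))}
    (hCm : ∀ k, MeasurableSet (C k)) (hCB : ∀ k, C k ⊆ B)
    (hC : Pairwise fun j k => Disjoint (C j) (C k)) :
    orderedPoints X P B n (pi univ C) =
      ENNReal.ofReal (Real.exp (-(ENNReal.ofReal l * volume B).toNNReal)) *
        ∏ k, (ENNReal.ofReal l * volume (C k)) := by
  have hpi : MeasurableSet (pi univ C) := MeasurableSet.univ_pi hCm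
  have hfin : ∀ k, volume (C k) ≠ ∞ := fun k => measure_ne_top_of_subset (hCB k) hB'
  have hrest : volume (B \ ⋃ k, C k) ≠ ∞ := measure_ne_top_of_subset sdiff_subset hB'
  have hrm : MeasurableSet (B \ ⋃ k, C k) := hB.diff (MeasurableSet.iUnion hCm)
  rw [orderedPoints_apply h.measurable hpi,
    ← measure_iUnion (pairwise_disjoint_pointsExactlyAt_inter_pi hC)
      fun σ => measurableSet_pointsExactlyAt_inter h.measurable hB σ hpi,
    iUnion_pointsExactlyAt_inter_pi hCB hC,
    (h.indep (n + 1) (Fin.cons (B \ ⋃ k, C k) C) (Fin.cases hrm hCm) ?_).measure_inter_preimage_eq_mul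
      _ fun _ _ => measurableSet_singleton _, Fin.prod_univ_succ]
  · simp only [Fin.cons_zero, Fin.cons_succ]
    have h0 := h.measure_pointCount_eq hrm hrest 0
    have h1 := fun k => h.measure_pointCount_eq (hCm k) (hfin k) 1
    simp only [poissonMeasure_singleton] at h0 h1
    simp only [Nat.cast_zero, Nat.cast_one, pow_zero, pow_one, mul_one, Nat.factorial_zero,
      Nat.factorial_one, div_one] at h0 h1
    have hsplit : ENNReal.ofReal l * volume B =
        ENNReal.ofReal l * volume (B \ ⋃ k, C k) + ∑ k, ENNReal.ofReal l * volume (C k) := by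
      rw [← Finset.mul_sum, ← mul_add]
      congr 1
      rw [← measure_sdiff_add_inter B (MeasurableSet.iUnion hCm),
        inter_eq_right.2 (iUnion_subset hCB), measure_iUnion hC hCm, tsum_fintype]
    have hne : ∀ {S : Set (EuclideanSpace ℝ (Fin d))}, volume S ≠ ∞ →
        ENNReal.ofReal l * volume S ≠ ∞ := fun hS => ENNReal.mul_ne_top ENNReal.ofReal_ne_top hS
    have hr : ((ENNReal.ofReal l * volume B).toNNReal : ℝ) =
        (ENNReal.ofReal l * volume (B \ ⋃ k, C k)).toNNReal +
          ∑ k, ((ENNReal.ofReal l * volume (C k)).toNNReal : ℝ) := by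
      rw [hsplit, ENNReal.toNNReal_add (hne hrest) (ENNReal.sum_ne_top.2 fun k _ => hne (hfin k)),
        ENNReal.toNNReal_sum fun k _ => hne (hfin k)]
      push_cast
      rfl
    -- The void probability of the remainder and the `exp (-v)` in each one-point probability
    -- multiply to the void probability of `B`.
    rw [hr, neg_add, Real.exp_add, ENNReal.ofReal_mul (Real.exp_pos _).le, mul_assoc]
    refine congrArg₂ (· * ·) h0 ?_
    · rw [← Finset.sum_neg_distrib, Real.exp_sum,
        ENNReal.ofReal_prod_of_nonneg fun _ _ => (Real.exp_pos _).le, ← Finset.prod_mul_distrib]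
      refine Finset.prod_congr rfl fun k _ => (h1 k).trans ?_
      rw [ENNReal.ofReal_mul (Real.exp_pos _).le, ENNReal.ofReal_coe_nnreal,
        ENNReal.coe_toNNReal (hne (hfin k))]
  · have hd0 : ∀ k, Disjoint (B \ ⋃ k, C k) (C k) := fun k =>
      disjoint_sdiff_left.mono_right (subset_iUnion C k)
    intro i j
    refine Fin.cases ?_ (fun i => ?_) i <;> refine Fin.cases ?_ (fun j => ?_) j
    · simp
    · intro _; simpa using hd0 j
    · intro _; simpa using (hd0 i).symm
    · intro hij; simpa using hC fun e => hij (congrArg Fin.succ e)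

theorem tsum_indicator_range_eq (n : ℕ) (S : Set ℕ) :
    ∑' σ : Fin n ↪ ℕ, {σ : Fin n ↪ ℕ | range σ = S}.indicator (1 : (Fin n ↪ ℕ) → ℝ≥0∞) σ =
      {T : Set ℕ | T.encard = n}.indicator (fun _ => (n.factorial : ℝ≥0∞)) S := by
  rw [← tsum_subtype]
  simp only [Pi.one_apply]
  by_cases hS : S.encard = n
  · rw [indicator_of_mem (by exact hS)]
    have hfin : S.Finite := finite_of_encard_eq_coe hS
    have := hfin.fintype
    have hcard : Fintype.card S = n := by
      have := hS
      rwa [encard_eq_coe_toFinset_card, Nat.cast_inj, toFinset_card] at this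
    let e : {σ : Fin n ↪ ℕ | range σ = S} ≃ (Fin n ≃ S) :=
      { toFun := fun σ => (Equiv.ofInjective _ σ.1.injective).trans (Equiv.setCongr σ.2)
        invFun := fun τ => ⟨τ.toEmbedding.trans (Function.Embedding.subtype _), by
          ext i
          simp only [mem_range, Function.Embedding.trans_apply, Equiv.coe_toEmbedding,
            Function.Embedding.subtype_apply]
          exact ⟨fun ⟨k, hk⟩ => hk ▸ (τ k).2, fun hi => ⟨τ.symm ⟨i, hi⟩, by simp⟩⟩⟩
        left_inv := fun σ => by ext; rfl
        right_inv := fun τ => by ext; rfl }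
    rw [e.tsum_eq (fun _ => (1 : ℝ≥0∞)), tsum_fintype]
    simp [Fintype.card_equiv (Fintype.equivFinOfCardEq hcard).symm]
  · rw [indicator_of_notMem (by exact hS)]
    have : IsEmpty {σ : Fin n ↪ ℕ | range σ = S} := ⟨fun σ => hS (by
      rw [← σ.2, ← image_univ, σ.1.injective.encard_image, encard_univ]; simp)⟩
    simp

theorem tsum_indicator_pointsExactlyAt {Ω : Type*} (X : ℕ → Ω → EuclideanSpace ℝ (Fin d)) (ω : Ω) :
    ∑' σ : Fin n ↪ ℕ, (pointsExactlyAt X B σ).indicator (1 : Ω → ℝ≥0∞) ω =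
      {ω | pointCount X B ω = n}.indicator (fun _ => (n.factorial : ℝ≥0∞)) ω := by
  have := tsum_indicator_range_eq n {i | X i ω ∈ B}
  convert! this using 3 with σ
  · refine indicator_eq_indicator ?_ rfl
    simp only [pointsExactlyAt, mem_ofPred_eq, Set.ext_iff]
    exact forall_congr' fun i => Iff.comm

theorem measurableSet_pointCount_eq (hX : ∀ i, Measurable (X i)) (hB : MeasurableSet B) (n : ℕ) :
    MeasurableSet {ω | pointCount X B ω = n} := by
  have : {ω | pointCount X B ω = n} = ⋃ σ : Fin n ↪ ℕ, pointsExactlyAt X B σ := by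
    ext ω
    have := tsum_indicator_pointsExactlyAt (n := n) (B := B) X ω
    by_cases hω : pointCount X B ω = n
    · rw [indicator_of_mem (by exact hω)] at this
      refine iff_of_true hω ?_
      by_contra hne
      simp only [mem_iUnion, not_exists] at hne
      simp only [hne, not_false_eq_true, indicator_of_notMem, tsum_zero] at this
      exact Nat.factorial_ne_zero n (by exact_mod_cast this.symm)
    · rw [indicator_of_notMem (by exact hω), ENNReal.tsum_eq_zero] at this
      refine iff_of_false hω ?_
      simpa using this
  rw [this]
  exact MeasurableSet.iUnion fun σ => measurableSet_pointsExactlyAt hX hB σ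

/-- Each configuration of `n` points is counted `n!` times, which cancels the factorial in the
Poisson weight. This total mass later excludes mass on the diagonals, which disjoint rectangles
cannot see. -/
theorem orderedPoints_univ [IsProbabilityMeasure P] (h : IsPoissonProcess l P X)
    (hB : MeasurableSet B) (hB' : volume B ≠ ∞) :
    orderedPoints X P B n univ =
      ENNReal.ofReal (Real.exp (-(ENNReal.ofReal l * volume B).toNNReal)) *
        (ENNReal.ofReal l * volume B) ^ n := by
  have hm := measurableSet_pointCount_eq h.measurable hB n
  rw [orderedPoints_apply h.measurable MeasurableSet.univ]
  calc _ = ∑' σ : Fin n ↪ ℕ, ∫⁻ ω, (pointsExactlyAt X B σ).indicator 1 ω ∂P := by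
        refine tsum_congr fun σ => ?_
        rw [lintegral_indicator_one (measurableSet_pointsExactlyAt h.measurable hB σ)]
        simp
    _ = ∫⁻ ω, {ω | pointCount X B ω = n}.indicator (fun _ => (n.factorial : ℝ≥0∞)) ω ∂P := by
        rw [← lintegral_tsum fun σ => (measurable_one.indicator
          (measurableSet_pointsExactlyAt h.measurable hB σ)).aemeasurable]
        exact lintegral_congr fun ω => tsum_indicator_pointsExactlyAt X ω
    _ = _ := by
        rw [lintegral_indicator_const hm, h.measure_pointCount_eq hB hB', poissonMeasure_singleton,
          mul_div_assoc, ENNReal.ofReal_mul (Real.exp_pos _).le, mul_left_comm]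
        congr 1
        have hne : ENNReal.ofReal l * volume B ≠ ∞ := ENNReal.mul_ne_top ENNReal.ofReal_ne_top hB'
        rw [← ENNReal.ofReal_natCast, ← ENNReal.ofReal_mul (by positivity),
          mul_div_cancel₀ _ (by positivity), ENNReal.ofReal_pow (by positivity),
          ENNReal.ofReal_coe_nnreal, ENNReal.coe_toNNReal hne]

/-- Distinct points have disjoint basic neighbourhoods, and a countable basis has only countably
many `n`-tuples. -/
theorem exists_disjoint_cover_injective (E : Type*) [MetricSpace E] [SecondCountableTopology E]
    [MeasurableSpace E] [BorelSpace E] (n : ℕ) :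
    ∃ (ι : Type) (_ : Countable ι) (C : ι → Fin n → Set E),
      (∀ i k, MeasurableSet (C i k)) ∧ (∀ i, Pairwise fun j k => Disjoint (C i j) (C i k)) ∧
      ⋃ i, pi univ (C i) = {x : Fin n → E | Function.Injective x} := by
  let b := TopologicalSpace.countableBasis E
  have hb := TopologicalSpace.isBasis_countableBasis E
  have : Countable b := (TopologicalSpace.countable_countableBasis E).to_subtype
  have : Countable {C : Fin n → b // Pairwise fun j k => Disjoint (C j : Set E) (C k)} :=
    inferInstance
  -- The index set is moved to `Type`, as `E` may live in any universe.
  obtain ⟨ι, ⟨e⟩⟩ : ∃ ι : Type,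
      Nonempty (ι ≃ {C : Fin n → b // Pairwise fun j k => Disjoint (C j : Set E) (C k)}) := by
    obtain ⟨f, hf⟩ := exists_injective_nat
      {C : Fin n → b // Pairwise fun j k => Disjoint (C j : Set E) (C k)}
    exact ⟨range f, ⟨(Equiv.ofInjective f hf).symm⟩⟩
  refine ⟨ι, e.injective.countable, fun i k => ((e i).1 k : Set E),
    fun i k => (hb.isOpen ((e i).1 k).2).measurableSet, fun i => (e i).2, ?_⟩
  ext x
  simp only [mem_iUnion, mem_pi, mem_univ, true_imp_iff, mem_ofPred_eq]
  constructor
  · rintro ⟨i, hi⟩ j k hjk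
    by_contra hne
    exact disjoint_left.1 ((e i).2 hne) (hi j) (hjk ▸ hi k)
  · intro hx
    obtain ⟨V, hV, hdis⟩ := (finite_range x).t2_separation
    have := fun k => hb.exists_subset_of_mem_open (hV (x k)).1 (hV (x k)).2
    choose W hW hxW hWV using this
    refine ⟨e.symm ⟨fun k => ⟨W k, hW k⟩, fun j k hjk => ?_⟩, fun k => by simpa using hxW k⟩
    exact (hdis (mem_range_self j) (mem_range_self k) (hx.ne hjk)).mono (hWV j) (hWV k)

theorem orderedPoints_compl_pi_eq_zero (hX : ∀ i, Measurable (X i)) (hB : MeasurableSet B) :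
    orderedPoints X P B n (pi univ fun _ => B)ᶜ = 0 := by
  rw [orderedPoints_apply hX (MeasurableSet.univ_pi fun _ => hB).compl, ENNReal.tsum_eq_zero]
  intro σ
  convert measure_empty (μ := P)
  rw [eq_empty_iff_forall_notMem]
  rintro ω ⟨hσ, hne⟩
  exact hne fun k _ => (hσ _).2 ⟨k, rfl⟩

/-- Each diagonal `x j = x k` is a linear subspace, proper because `d ≥ 1`, hence null. -/
theorem ae_injective_pi_restrict (hd : 1 ≤ d) (B : Set (EuclideanSpace ℝ (Fin d))) (n : ℕ) :
    ∀ᵐ x ∂(Measure.pi fun _ : Fin n => (volume : Measure (EuclideanSpace ℝ (Fin d))).restrict B),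
      Function.Injective x := by
  have : NeZero d := ⟨by omega⟩
  rw [← Measure.restrict_pi_pi]
  refine ae_restrict_of_ae ?_
  have key : ∀ j k : Fin n, j ≠ k →
      ∀ᵐ x ∂(Measure.pi fun _ : Fin n => (volume : Measure (EuclideanSpace ℝ (Fin d)))),
        x j ≠ x k := by
    intro j k hjk
    have := Measure.addHaar_submodule
      (Measure.pi fun _ : Fin n => (volume : Measure (EuclideanSpace ℝ (Fin d))))
      (LinearMap.ker ((LinearMap.proj j : (Fin n → EuclideanSpace ℝ (Fin d)) →ₗ[ℝ] _) -
        LinearMap.proj k)) (fun htop => ?_)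
    · rw [ae_iff]
      convert this using 2
      ext x
      simp [sub_eq_zero]
    · have hmem : (Pi.single j (EuclideanSpace.single 0 1) : Fin n → EuclideanSpace ℝ (Fin d)) ∈
        LinearMap.ker ((LinearMap.proj j : (Fin n → EuclideanSpace ℝ (Fin d)) →ₗ[ℝ] _) -
        LinearMap.proj k) := htop ▸ Submodule.mem_top
      simp [hjk.symm] at hmem
  have := ae_all_iff.2 fun j => ae_all_iff.2 fun k => ae_all_iff.2 (key j k)
  filter_upwards [this] with x hx j k hjk
  by_contra hne
  exact hx j k hne hjk

/-- Both measures agree on rectangles with disjoint sides, hence on the injective vectors, which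
countably many such rectangles cover. Equal total mass then leaves nothing for the non-injective
vectors. -/
theorem orderedPoints_eq [IsProbabilityMeasure P] (hd : 1 ≤ d) (h : IsPoissonProcess l P X)
    (hB : MeasurableSet B) (hB' : volume B ≠ ∞) :
    orderedPoints X P B n =
      (ENNReal.ofReal (Real.exp (-(ENNReal.ofReal l * volume B).toNNReal)) *
        ENNReal.ofReal l ^ n) • Measure.pi fun _ : Fin n => volume.restrict B := by
  set M := orderedPoints X P B n with hM
  set c := ENNReal.ofReal (Real.exp (-(ENNReal.ofReal l * volume B).toNNReal)) *
        ENNReal.ofReal l ^ n with hc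
  have hcfin : c ≠ ∞ := ENNReal.mul_ne_top ENNReal.ofReal_ne_top (by finiteness)
  have : Fact (volume B < ∞) := ⟨hB'.lt_top⟩
  have hMu : M univ = (c • Measure.pi fun _ : Fin n => volume.restrict B) univ := by
    rw [hM, orderedPoints_univ h hB hB', hc]
    simp [mul_pow, mul_assoc, Measure.pi_univ]
  have : IsFiniteMeasure (c • Measure.pi fun _ : Fin n =>
      (volume : Measure (EuclideanSpace ℝ (Fin d))).restrict B) := Measure.smul_finite _ hcfin
  have : IsFiniteMeasure M := ⟨hMu ▸ measure_lt_top _ _⟩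
  have hrect : ∀ C : Fin n → Set (EuclideanSpace ℝ (Fin d)), (∀ k, MeasurableSet (C k)) →
      (Pairwise fun j k => Disjoint (C j) (C k)) →
      M (pi univ C) = (c • Measure.pi fun _ : Fin n => volume.restrict B) (pi univ C) := by
    intro C hCm hC
    have h0 : M (pi univ C \ pi univ fun _ => B) = 0 :=
      measure_mono_null (fun _ hx => hx.2) (orderedPoints_compl_pi_eq_zero h.measurable hB)
    have h1 : M (pi univ C) = M (pi univ fun k => C k ∩ B) := by
      rw [← measure_inter_add_sdiff (pi univ C) (MeasurableSet.univ_pi fun _ : Fin n => hB), h0,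
        add_zero, ← pi_inter_distrib]
    rw [h1, hM, orderedPoints_pi_of_disjoint h hB hB' (fun k => (hCm k).inter hB)
      (fun k => inter_subset_right)
      (fun j k hjk => (hC hjk).mono inter_subset_left inter_subset_left)]
    simp [Measure.pi_pi, Measure.restrict_apply (hCm _), hc, Finset.prod_mul_distrib, mul_assoc]
  obtain ⟨ι, _, C, hCm, hC, hcover⟩ := exists_disjoint_cover_injective (EuclideanSpace ℝ (Fin d)) n
  have hDm : MeasurableSet {x : Fin n → EuclideanSpace ℝ (Fin d) | Function.Injective x} := by
    rw [← hcover]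
    exact MeasurableSet.iUnion fun i => MeasurableSet.univ_pi (hCm i)
  have hrestr : M.restrict {x | Function.Injective x} =
      (c • Measure.pi fun _ : Fin n => volume.restrict B).restrict {x | Function.Injective x} := by
    rw [← hcover, Measure.restrict_iUnion_congr]
    intro i
    -- Inside one covering rectangle, intersecting with any measurable rectangle keeps the sides
    -- disjoint, so the π-system of all rectangles is available.
    refine ext_of_generate_finite _ generateFrom_pi.symm (isPiSystem_pi) ?_ ?_
    · rintro _ ⟨S, hS, rfl⟩
      have hSm : ∀ k, MeasurableSet (S k) := fun k => hS k trivial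
      rw [Measure.restrict_apply (MeasurableSet.univ_pi hSm),
        Measure.restrict_apply (MeasurableSet.univ_pi hSm), ← pi_inter_distrib]
      exact hrect _ (fun k => (hSm k).inter (hCm i k))
        (fun j k hjk => (hC i hjk).mono inter_subset_right inter_subset_right)
    · simpa using hrect _ (hCm i) (hC i)
  have hinj := ae_injective_pi_restrict hd B n
  have hinj' : ∀ᵐ x ∂(c • Measure.pi fun _ : Fin n =>
      (volume : Measure (EuclideanSpace ℝ (Fin d))).restrict B), Function.Injective x :=
    Measure.ae_smul_measure hinj c
  have hMinj : ∀ᵐ x ∂M, Function.Injective x := by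
    rw [ae_iff]
    change M {x | Function.Injective x}ᶜ = 0
    -- The mass off the injective vectors is total mass minus mass on them; both coincide with those
    -- of the product measure, which does not charge the diagonals.
    rw [measure_compl hDm (measure_ne_top _ _), hMu,
      ← Measure.restrict_apply_univ (s := {x | Function.Injective x}), hrestr,
      Measure.restrict_eq_self_of_ae_mem (s := {x | Function.Injective x}) hinj', tsub_self]
  rw [← Measure.restrict_eq_self_of_ae_mem (s := {x | Function.Injective x}) hMinj]
  exact hrestr.trans (Measure.restrict_eq_self_of_ae_mem hinj')

end

/-! ### Deterministic marked graphs: monotonicity, locality, measurability. -/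

/-- The relation `markedEdge` for deterministic positions `y` and marks `u` indexed by an arbitrary
type `V`. -/
def markedEdgeOn {d : ℕ} {V : Type*}
    (r : EuclideanSpace ℝ (Fin d) → EuclideanSpace ℝ (Fin d) → Prop)
    (ψ : EuclideanSpace ℝ (Fin d) → ℝ) (y : V → EuclideanSpace ℝ (Fin d))
    (u : Option V × V → ℝ) : Option V → Option V → Prop
  | none, some j => u (none, j) ≤ ψ (0 - y j)
  | some i, some j => r (y i) (y j) ∧ u (some i, j) ≤ ψ (y i - y j)
  | _, none => False

/-- The position of a vertex, the additional vertex `none` being at the origin. -/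
def optionPos {d : ℕ} {V : Type*} (y : V → EuclideanSpace ℝ (Fin d)) (v : Option V) :
    EuclideanSpace ℝ (Fin d) :=
  v.elim 0 y

/-- The origin is connected to the complement of the box of side length `t` in the graph with
positions `y` and marks `u`. -/
def Exits {d : ℕ} {V : Type*}
    (r : EuclideanSpace ℝ (Fin d) → EuclideanSpace ℝ (Fin d) → Prop)
    (ψ : EuclideanSpace ℝ (Fin d) → ℝ) (t : ℝ) (y : V → EuclideanSpace ℝ (Fin d))
    (u : Option V × V → ℝ) : Prop :=
  ∃ v, optionPos y v ∈ (centeredBox d t)ᶜ ∧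
    (SimpleGraph.fromRel (markedEdgeOn r ψ y u)).Reachable none v

/-- The marks of the pairs of vertices in the range of `σ`. -/
def pullMarks {V W : Type*} (σ : V → W) (u : Option W × W → ℝ) (p : Option V × V) : ℝ :=
  u (p.1.map σ, σ p.2)

section
variable {d : ℕ} {V W : Type*} {r : EuclideanSpace ℝ (Fin d) → EuclideanSpace ℝ (Fin d) → Prop}
  {ψ : EuclideanSpace ℝ (Fin d) → ℝ} {t : ℝ}

theorem connectsOutside_eq {Ω : Type*} (X : ℕ → Ω → EuclideanSpace ℝ (Fin d))
    (U : Option ℕ → ℕ → Ω → ℝ) :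
    connectsOutside r ψ X U t = {ω | Exits r ψ t (fun i => X i ω) fun p => U p.1 p.2 ω} := by
  have h1 : ∀ ω, vertexPos X ω = optionPos fun i => X i ω := fun ω => by
    funext v; cases v <;> rfl
  have h2 : ∀ ω, markedEdge r ψ X U ω = markedEdgeOn r ψ (fun i => X i ω) fun p => U p.1 p.2 ω :=
    fun ω => by funext a b; cases a <;> cases b <;> rfl
  simp only [connectsOutside, Exits, rcmGraph, h1, h2]

theorem optionPos_map (σ : V → W) (y : W → EuclideanSpace ℝ (Fin d)) (v : Option V) :
    optionPos y (v.map σ) = optionPos (y ∘ σ) v := by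
  cases v <;> rfl

theorem markedEdgeOn_map (σ : V → W) (y : W → EuclideanSpace ℝ (Fin d)) (u : Option W × W → ℝ)
    (a b : Option V) :
    markedEdgeOn r ψ (y ∘ σ) (pullMarks σ u) a b ↔
      markedEdgeOn r ψ y u (a.map σ) (b.map σ) := by
  cases a <;> cases b <;> rfl

theorem fromRel_markedEdgeOn_map (σ : V ↪ W) (y : W → EuclideanSpace ℝ (Fin d))
    (u : Option W × W → ℝ) (a b : Option V) :
    (SimpleGraph.fromRel (markedEdgeOn r ψ (y ∘ σ) (pullMarks σ u))).Adj a b ↔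
      (SimpleGraph.fromRel (markedEdgeOn r ψ y u)).Adj (a.map σ) (b.map σ) := by
  simp only [SimpleGraph.fromRel_adj, markedEdgeOn_map, ne_eq,
    (Option.map_injective σ.injective).eq_iff]

theorem Exits.of_embedding (σ : V ↪ W) {y : W → EuclideanSpace ℝ (Fin d)}
    {u : Option W × W → ℝ} (h : Exits r ψ t (y ∘ σ) (pullMarks σ u)) : Exits r ψ t y u := by
  obtain ⟨v, hv, hreach⟩ := h
  let f : SimpleGraph.fromRel (markedEdgeOn r ψ (y ∘ σ) (pullMarks σ u)) →g
      SimpleGraph.fromRel (markedEdgeOn r ψ y u) :=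
    ⟨Option.map σ, fun {a b} hab => (fromRel_markedEdgeOn_map σ y u a b).1 hab⟩
  exact ⟨v.map σ, by rwa [optionPos_map], hreach.map f⟩

/-- Positivity of the marks matters: a zero mark would allow an edge where `ψ` vanishes, at any
distance. -/
theorem norm_sub_le_of_markedEdgeOn (hψ : IsConnectionFunction ψ)
    {y : V → EuclideanSpace ℝ (Fin d)} {u : Option V × V → ℝ} (hu : ∀ p, 0 < u p)
    {a b : Option V} (h : markedEdgeOn r ψ y u a b) : ‖optionPos y a - optionPos y b‖ ≤ 1 := by
  have key : ∀ p x, u p ≤ ψ x → ‖x‖ ≤ 1 := fun p x hx => by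
    simpa using hψ.support_subset (show ψ x ≠ 0 from ((hu p).trans_le hx).ne')
  cases a <;> cases b
  · exact h.elim
  · exact key _ _ h
  · exact h.elim
  · exact key _ _ h.2

theorem norm_sub_le_of_adj (hψ : IsConnectionFunction ψ)
    {y : V → EuclideanSpace ℝ (Fin d)} {u : Option V × V → ℝ} (hu : ∀ p, 0 < u p)
    {a b : Option V} (h : (SimpleGraph.fromRel (markedEdgeOn r ψ y u)).Adj a b) :
    ‖optionPos y b - optionPos y a‖ ≤ 1 := by
  rcases ((SimpleGraph.fromRel_adj _ _ _).1 h).2 with h | h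
  · rw [norm_sub_rev]
    exact norm_sub_le_of_markedEdgeOn hψ hu h
  · exact norm_sub_le_of_markedEdgeOn hψ hu h

theorem mem_centeredBox_add_two {x z : EuclideanSpace ℝ (Fin d)} (hx : x ∈ centeredBox d t)
    (hz : ‖z - x‖ ≤ 1) : z ∈ centeredBox d (t + 2) := by
  intro k
  have h1 := (PiLp.norm_apply_le (z - x) k).trans hz
  rw [PiLp.sub_apply, Real.norm_eq_abs, abs_le] at h1
  have h2 := hx k
  rw [mem_Icc] at h2 ⊢
  constructor <;> linarith [h1.1, h1.2, h2.1, h2.2]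

theorem Exits.restrict (hψ : IsConnectionFunction ψ) (ht : 0 ≤ t) (σ : V ↪ W)
    {y : W → EuclideanSpace ℝ (Fin d)} {u : Option W × W → ℝ} (hu : ∀ p, 0 < u p)
    (hσ : ∀ i, y i ∈ centeredBox d (t + 2) → i ∈ range σ) (h : Exits r ψ t y u) :
    Exits r ψ t (y ∘ σ) (pullMarks σ u) := by
  obtain ⟨v, hv, hreach⟩ := h
  by_contra hne
  -- If the restricted graph never exits, induction along the path keeps each vertex in the box and
  -- lifts it to `V`: the next vertex is within distance one, so in the larger box and in the range
  -- of `σ`. The endpoint then contradicts `hv`.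
  have key : optionPos y v ∈ centeredBox d t ∧ ∃ v' : Option V, v'.map σ = v ∧
      (SimpleGraph.fromRel (markedEdgeOn r ψ (y ∘ σ) (pullMarks σ u))).Reachable none v' := by
    rw [SimpleGraph.reachable_iff_reflTransGen] at hreach
    clear hv
    induction hreach with
    | refl => exact ⟨fun k => by simp [optionPos]; linarith, none, rfl, SimpleGraph.Reachable.refl _⟩
    | @tail b c _ hbc ih =>
      obtain ⟨hb, b', rfl, hb'⟩ := ih
      have hc := mem_centeredBox_add_two hb (norm_sub_le_of_adj hψ hu hbc)
      obtain ⟨c', rfl⟩ : ∃ c' : Option V, c'.map σ = c := by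
        cases c with
        | none => exact ⟨none, rfl⟩
        | some i =>
          obtain ⟨j, rfl⟩ := hσ i hc
          exact ⟨some j, rfl⟩
      have hc' := hb'.trans ((fromRel_markedEdgeOn_map σ y u b' c').2 hbc).reachable
      refine ⟨?_, c', rfl, hc'⟩
      by_contra hout
      exact hne ⟨c', by rwa [← optionPos_map], hc'⟩
  exact hv key.1

theorem exits_iff_exits_restrict (hψ : IsConnectionFunction ψ) (ht : 0 ≤ t) (σ : V ↪ W)
    {y : W → EuclideanSpace ℝ (Fin d)} {u : Option W × W → ℝ} (hu : ∀ p, 0 < u p)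
    (hσ : ∀ i, y i ∈ centeredBox d (t + 2) → i ∈ range σ) :
    Exits r ψ t y u ↔ Exits r ψ t (y ∘ σ) (pullMarks σ u) :=
  ⟨Exits.restrict hψ ht σ hu hσ, Exits.of_embedding σ⟩

theorem Exits.anti {s : ℝ} (hst : s ≤ t) {y : V → EuclideanSpace ℝ (Fin d)}
    {u : Option V × V → ℝ} (h : Exits r ψ t y u) : Exits r ψ s y u := by
  obtain ⟨v, hv, hreach⟩ := h
  refine ⟨v, fun hs => hv fun k => ?_, hreach⟩
  have := hs k
  rw [mem_Icc] at this ⊢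
  constructor <;> linarith [this.1, this.2]

theorem isClosed_centeredBox (d : ℕ) (t : ℝ) : IsClosed (centeredBox d t) := by
  rw [centeredBox, ofPred_forall]
  exact isClosed_iInter fun k => isClosed_Icc.preimage (by fun_prop)

/-- Reachability is a countable union over walk lengths, and a walk of given length splits off its
first edge. -/
theorem measurableSet_reachable {α V : Type*} [MeasurableSpace α] [Countable V]
    {G : α → SimpleGraph V} (hG : ∀ a b, MeasurableSet {q | (G q).Adj a b}) (a b : V) :
    MeasurableSet {q | (G q).Reachable a b} := by
  have key : ∀ n (a b : V), MeasurableSet {q | ∃ p : (G q).Walk a b, p.length = n} := by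
    intro n
    induction n with
    | zero =>
      intro a b
      simp only [SimpleGraph.Walk.exists_length_eq_zero_iff]
      exact MeasurableSet.const _
    | succ n ih =>
      intro a b
      have : {q | ∃ p : (G q).Walk a b, p.length = n + 1} =
          ⋃ c, {q | (G q).Adj a c} ∩ {q | ∃ p : (G q).Walk c b, p.length = n} := by
        ext q
        simp only [mem_ofPred_eq, mem_iUnion, mem_inter_iff]
        constructor
        · rintro ⟨p, hp⟩
          cases p with
          | nil => simp at hp
          | cons h p => exact ⟨_, h, p, by simpa using hp⟩
        · rintro ⟨c, h, p, hp⟩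
          exact ⟨.cons h p, by simpa using hp⟩
      rw [this]
      exact MeasurableSet.iUnion fun c => (hG a c).inter (ih c b)
  have : {q | (G q).Reachable a b} = ⋃ n, {q | ∃ p : (G q).Walk a b, p.length = n} := by
    ext q
    simp only [mem_ofPred_eq, mem_iUnion]
    exact ⟨fun ⟨p⟩ => ⟨_, p, rfl⟩, fun ⟨_, p, _⟩ => ⟨p⟩⟩
  rw [this]
  exact MeasurableSet.iUnion fun n => key n a b

theorem measurableSet_markedEdgeOn
    (hr : MeasurableSet {p : EuclideanSpace ℝ (Fin d) × EuclideanSpace ℝ (Fin d) | r p.1 p.2})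
    (hψ : Measurable ψ) (a b : Option V) :
    MeasurableSet {q : (V → EuclideanSpace ℝ (Fin d)) × (Option V × V → ℝ) |
      markedEdgeOn r ψ q.1 q.2 a b} := by
  cases a <;> cases b
  · exact MeasurableSet.const False
  · exact measurableSet_le (by fun_prop) (hψ.comp (by fun_prop))
  · exact MeasurableSet.const False
  · rename_i i j
    refine MeasurableSet.inter ?_ (measurableSet_le (by fun_prop) (hψ.comp (by fun_prop)))
    exact measurableSet_preimage (f := fun q : (V → EuclideanSpace ℝ (Fin d)) ×
      (Option V × V → ℝ) => (q.1 i, q.1 j)) (by fun_prop) hr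

theorem measurableSet_exits [Countable V]
    (hr : MeasurableSet {p : EuclideanSpace ℝ (Fin d) × EuclideanSpace ℝ (Fin d) | r p.1 p.2})
    (hψ : Measurable ψ) (t : ℝ) :
    MeasurableSet {q : (V → EuclideanSpace ℝ (Fin d)) × (Option V × V → ℝ) |
      Exits r ψ t q.1 q.2} := by
  simp only [Exits]
  rw [ofPred_exists]
  refine MeasurableSet.iUnion fun v => MeasurableSet.inter ?_ ?_
  · have : Measurable fun q : (V → EuclideanSpace ℝ (Fin d)) × (Option V × V → ℝ) =>
        optionPos q.1 v := by
      cases v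
      · exact measurable_const
      · rename_i i
        exact (measurable_pi_apply i).comp measurable_fst
    exact this (isClosed_centeredBox d t).measurableSet.compl
  · refine measurableSet_reachable (fun a b => ?_) _ _
    simp only [SimpleGraph.fromRel_adj]
    exact (MeasurableSet.const _).inter ((measurableSet_markedEdgeOn hr hψ a b).union
      (measurableSet_markedEdgeOn hr hψ b a))

end

/-! ### Exit probabilities averaged over marks and uniform points. -/

theorem map_comp_pi_const {ι κ 𝓧 : Type*} [Fintype ι] [Fintype κ] [MeasurableSpace 𝓧]
    (μ : Measure 𝓧) [IsProbabilityMeasure μ] {g : ι → κ} (hg : Function.Injective g) :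
    (Measure.pi fun _ : κ => μ).map (fun x i => x (g i)) = Measure.pi fun _ : ι => μ := by
  have h : iIndepFun (fun (k : κ) (x : κ → 𝓧) => x k) (Measure.pi fun _ : κ => μ) :=
    iIndepFun_pi (X := fun _ => id) fun _ => aemeasurable_id
  exact ((h.precomp hg).hasLaw_pi fun i => (measurePreserving_eval (fun _ : κ => μ) (g i)).hasLaw).map_eq

theorem isCompact_centeredBox (d : ℕ) (t : ℝ) : IsCompact (centeredBox d t) := by
  have : centeredBox d t = (EuclideanSpace.equiv (Fin d) ℝ).toHomeomorph ⁻¹'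
      (pi univ fun _ => Icc (-(t / 2)) (t / 2)) := by
    ext x
    simp [centeredBox, PiLp.coe_continuousLinearEquiv, Pi.le_def, forall_and]
  rw [this, Homeomorph.isCompact_preimage]
  exact isCompact_univ_pi fun _ => isCompact_Icc

theorem volume_centeredBox_ne_top (d : ℕ) (t : ℝ) : volume (centeredBox d t) ≠ ∞ :=
  (isCompact_centeredBox d t).measure_ne_top

theorem volume_centeredBox_pos {d : ℕ} {t : ℝ} (ht : 0 < t) : 0 < volume (centeredBox d t) := by
  refine (Metric.measure_ball_pos volume 0 (half_pos ht)).trans_le (measure_mono fun x hx k => ?_)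
  have h1 := (PiLp.norm_apply_le x k).trans (mem_ball_zero_iff.1 hx).le
  rwa [Real.norm_eq_abs, abs_le] at h1

/-- The probability, over independent uniform marks, that the origin is connected to the complement
of the box of side length `t` in the graph with positions `y`. -/
noncomputable def exitProb {d : ℕ} {V : Type*} [Fintype V]
    (r : EuclideanSpace ℝ (Fin d) → EuclideanSpace ℝ (Fin d) → Prop)
    (ψ : EuclideanSpace ℝ (Fin d) → ℝ) (t : ℝ) (y : V → EuclideanSpace ℝ (Fin d)) : ℝ≥0∞ :=
  (Measure.pi fun _ : Option V × V => (volume : Measure ℝ).restrict (Icc 0 1))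
    {u | Exits r ψ t y u}

/-- The mean of `exitProb` over `n` independent uniform points in the box of side length `t + 2`. -/
noncomputable def meanExitProb {d : ℕ}
    (r : EuclideanSpace ℝ (Fin d) → EuclideanSpace ℝ (Fin d) → Prop)
    (ψ : EuclideanSpace ℝ (Fin d) → ℝ) (t : ℝ) (n : ℕ) : ℝ≥0∞ :=
  ∫⁻ y, exitProb r ψ t y ∂(Measure.pi fun _ : Fin n => cond volume (centeredBox d (t + 2)))

instance isProbabilityMeasure_volume_restrict_Icc_zero_one :
    IsProbabilityMeasure ((volume : Measure ℝ).restrict (Icc 0 1)) :=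
  ⟨by simp⟩

theorem pullMarks_injective {V W : Type*} {σ : V → W} (hσ : Function.Injective σ) :
    Function.Injective fun p : Option V × V => (p.1.map σ, σ p.2) := fun _ _ h =>
  Prod.ext (Option.map_injective hσ (congrArg Prod.fst h)) (hσ (congrArg Prod.snd h))

section
variable {d : ℕ} {V W : Type*} {r : EuclideanSpace ℝ (Fin d) → EuclideanSpace ℝ (Fin d) → Prop}
  {ψ : EuclideanSpace ℝ (Fin d) → ℝ} {t : ℝ}

theorem measurable_pullMarks (σ : V → W) : Measurable (pullMarks σ) :=
  measurable_pi_lambda _ fun _ => measurable_pi_apply _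

theorem measurable_exitProb [Fintype V]
    (hr : MeasurableSet {p : EuclideanSpace ℝ (Fin d) × EuclideanSpace ℝ (Fin d) | r p.1 p.2})
    (hψ : Measurable ψ) :
    Measurable (exitProb r ψ t : (V → EuclideanSpace ℝ (Fin d)) → ℝ≥0∞) :=
  measurable_measure_prodMk_left (measurableSet_exits hr hψ t)

/-- The smaller graph is sampled from the marks of the larger one, which makes the inclusion of
events pointwise. -/
theorem exitProb_comp_le [Fintype V] [Fintype W]
    (hr : MeasurableSet {p : EuclideanSpace ℝ (Fin d) × EuclideanSpace ℝ (Fin d) | r p.1 p.2})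
    (hψ : Measurable ψ) (σ : V ↪ W) (y : W → EuclideanSpace ℝ (Fin d)) :
    exitProb r ψ t (y ∘ σ) ≤ exitProb r ψ t y := by
  have hm : MeasurableSet {u | Exits r ψ t (y ∘ σ) u} :=
    measurable_prodMk_left (measurableSet_exits hr hψ t)
  rw [exitProb, ← map_comp_pi_const _ (pullMarks_injective σ.injective)]
  change (Measure.map (pullMarks σ) _) _ ≤ _
  rw [Measure.map_apply (measurable_pullMarks σ) hm]
  exact measure_mono fun u hu => Exits.of_embedding σ hu

theorem isProbabilityMeasure_cond_centeredBox (ht : 0 ≤ t) :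
    IsProbabilityMeasure (cond volume (centeredBox d (t + 2))) :=
  cond_isProbabilityMeasure_of_finite (volume_centeredBox_pos (by linarith)).ne'
    (volume_centeredBox_ne_top d _)

theorem meanExitProb_mono (ht : 0 ≤ t)
    (hr : MeasurableSet {p : EuclideanSpace ℝ (Fin d) × EuclideanSpace ℝ (Fin d) | r p.1 p.2})
    (hψ : Measurable ψ) : Monotone (meanExitProb r ψ t) := by
  have := isProbabilityMeasure_cond_centeredBox (d := d) ht
  refine monotone_nat_of_le_succ fun n => ?_
  rw [meanExitProb, ← map_comp_pi_const _ (Fin.castSucc_injective n),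
    lintegral_map (measurable_exitProb hr hψ) (by fun_prop)]
  exact lintegral_mono fun y => exitProb_comp_le hr hψ Fin.castSuccEmb y

theorem meanExitProb_le_one (ht : 0 ≤ t) (n : ℕ) : meanExitProb r ψ t n ≤ 1 := by
  have := isProbabilityMeasure_cond_centeredBox (d := d) ht
  calc meanExitProb r ψ t n
      ≤ ∫⁻ _, 1 ∂(Measure.pi fun _ : Fin n => cond volume (centeredBox d (t + 2))) :=
        lintegral_mono fun y => prob_le_one
    _ = 1 := by simp

theorem lintegral_pi_restrict_eq (ht : 0 ≤ t) (n : ℕ) :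
    ∫⁻ y, exitProb r ψ t y ∂(Measure.pi fun _ : Fin n =>
      (volume : Measure (EuclideanSpace ℝ (Fin d))).restrict (centeredBox d (t + 2))) =
      volume (centeredBox d (t + 2)) ^ n * meanExitProb r ψ t n := by
  have h0 := (volume_centeredBox_pos (d := d) (t := t + 2) (by linarith)).ne'
  have h1 := volume_centeredBox_ne_top d (t + 2)
  have := isProbabilityMeasure_cond_centeredBox (d := d) ht
  have : Fact (volume (centeredBox d (t + 2)) < ∞) := ⟨h1.lt_top⟩
  rw [meanExitProb, ← smul_eq_mul, ← lintegral_smul_measure]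
  congr 1
  refine Measure.pi_eq fun s hs => ?_
  rw [Measure.smul_apply, Measure.pi_pi, smul_eq_mul,
    show volume (centeredBox d (t + 2)) ^ n = ∏ _ : Fin n, volume (centeredBox d (t + 2)) by simp,
    ← Finset.prod_mul_distrib]
  refine Finset.prod_congr rfl fun k _ => ?_
  rw [ProbabilityTheory.cond, Measure.smul_apply, smul_eq_mul, ← mul_assoc, ENNReal.mul_inv_cancel h0 h1, one_mul]

/-! ### Connection probabilities of the random model as Poisson means. -/

variable {Ω : Type*} [MeasurableSpace Ω] {l : ℝ} {P : Measure Ω}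
  {X : ℕ → Ω → EuclideanSpace ℝ (Fin d)} {U : Option ℕ → ℕ → Ω → ℝ}

theorem IsIndependentEdgeMarking.ae_mark_pos (h : IsIndependentEdgeMarking l P X U) :
    ∀ᵐ ω ∂P, ∀ p : Option ℕ × ℕ, 0 < U p.1 p.2 ω := by
  refine ae_all_iff.2 fun p => ?_
  rw [(h.uniform_mark p.1 p.2).ae_iff (p := fun x => 0 < x) (by measurability),
    ← restrict_Ioc_eq_restrict_Icc]
  filter_upwards [ae_restrict_mem measurableSet_Ioc] with x hx using hx.1

theorem IsIndependentEdgeMarking.hasLaw_pullMarks (h : IsIndependentEdgeMarking l P X U) [Fintype V]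
    (σ : V ↪ ℕ) :
    HasLaw (fun ω => pullMarks σ fun p => U p.1 p.2 ω)
      (Measure.pi fun _ : Option V × V => (volume : Measure ℝ).restrict (Icc 0 1)) P :=
  (h.indep_mark.precomp (pullMarks_injective σ.injective)).hasLaw_pi fun _ => h.uniform_mark _ _

theorem IsIndependentEdgeMarking.measurable_points (h : IsIndependentEdgeMarking l P X U) :
    Measurable fun ω i => X i ω :=
  measurable_pi_lambda _ h.poisson.measurable

theorem IsIndependentEdgeMarking.measurable_marks (h : IsIndependentEdgeMarking l P X U) :
    Measurable fun ω (p : Option ℕ × ℕ) => U p.1 p.2 ω :=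
  measurable_pi_lambda _ fun p => h.measurable_mark p.1 p.2

theorem IsIndependentEdgeMarking.measurableSet_connectsOutside
    (h : IsIndependentEdgeMarking l P X U)
    (hr : MeasurableSet {p : EuclideanSpace ℝ (Fin d) × EuclideanSpace ℝ (Fin d) | r p.1 p.2})
    (hψ : Measurable ψ) (t : ℝ) : MeasurableSet (connectsOutside r ψ X U t) := by
  rw [connectsOutside_eq]
  exact (h.measurable_points.prodMk h.measurable_marks) (measurableSet_exits hr hψ t)

/-- Since `σ` is a fixed embedding, the marks pulled back along it are independent, uniform and
independent of all positions; Fubini then integrates them out. -/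
theorem IsIndependentEdgeMarking.measure_connectsOutside_inter_pointsExactlyAt
    [IsProbabilityMeasure P] (h : IsIndependentEdgeMarking l P X U)
    (hr : MeasurableSet {p : EuclideanSpace ℝ (Fin d) × EuclideanSpace ℝ (Fin d) | r p.1 p.2})
    (hψ : IsConnectionFunction ψ) (ht : 0 ≤ t) {n : ℕ} (σ : Fin n ↪ ℕ) :
    P (connectsOutside r ψ X U t ∩ pointsExactlyAt X (centeredBox d (t + 2)) σ) =
      ∫⁻ ω in pointsExactlyAt X (centeredBox d (t + 2)) σ, exitProb r ψ t (fun k => X (σ k) ω) ∂P := by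
  have hB : MeasurableSet (centeredBox d (t + 2)) := (isClosed_centeredBox d (t + 2)).measurableSet
  have hlaw := h.hasLaw_pullMarks σ
  have hind : IndepFun (fun ω i => X i ω) (fun ω => pullMarks σ fun p => U p.1 p.2 ω) P :=
    h.indep_points_marks.comp measurable_id (measurable_pullMarks σ)
  have hmap := (indepFun_iff_map_prod_eq_prod_map_map h.measurable_points.aemeasurable
    hlaw.aemeasurable).1 hind
  rw [hlaw.map_eq] at hmap
  let S : Set ((ℕ → EuclideanSpace ℝ (Fin d)) × (Option (Fin n) × Fin n → ℝ)) :=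
    {q | Exits r ψ t (q.1 ∘ σ) q.2} ∩
      {q | q.1 ∈ pointsExactlyAt (fun i x => x i) (centeredBox d (t + 2)) σ}
  have hPE : MeasurableSet (pointsExactlyAt
      (fun i (x : ℕ → EuclideanSpace ℝ (Fin d)) => x i) (centeredBox d (t + 2)) σ) :=
    measurableSet_pointsExactlyAt (fun i => measurable_pi_apply i) hB σ
  have hcomp : Measurable fun x : ℕ → EuclideanSpace ℝ (Fin d) => x ∘ σ :=
    measurable_pi_lambda _ fun k => measurable_pi_apply _
  have hS : MeasurableSet S := by
    refine MeasurableSet.inter ?_ (measurable_fst hPE)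
    exact ((hcomp.comp measurable_fst).prodMk measurable_snd) (measurableSet_exits hr hψ.measurable t)
  have hpair : Measurable fun ω => ((fun i => X i ω), pullMarks σ fun p => U p.1 p.2 ω) :=
    h.measurable_points.prodMk ((measurable_pullMarks σ).comp h.measurable_marks)
  calc P (connectsOutside r ψ X U t ∩ pointsExactlyAt X (centeredBox d (t + 2)) σ)
      = P ((fun ω => ((fun i => X i ω), pullMarks σ fun p => U p.1 p.2 ω)) ⁻¹' S) := by
        rw [connectsOutside_eq]
        refine measure_congr ?_
        filter_upwards [h.ae_mark_pos] with ω hω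
        refine propext (and_congr_left fun hσ => ?_)
        -- By locality only the points with index in the range of `σ` matter on this event.
        exact exits_iff_exits_restrict hψ ht σ hω fun i hi => (hσ i).1 hi
    _ = ∫⁻ x, (pointsExactlyAt (fun i x => x i) (centeredBox d (t + 2)) σ).indicator
          (fun x => exitProb r ψ t (x ∘ σ)) x ∂(P.map fun ω i => X i ω) := by
        rw [← Measure.map_apply hpair hS, hmap, Measure.prod_apply hS]
        refine lintegral_congr fun x => ?_
        by_cases hx : x ∈ pointsExactlyAt (fun i x => x i) (centeredBox d (t + 2)) σ
        · rw [indicator_of_mem hx, exitProb]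
          congr 1
          ext u
          exact and_iff_left hx
        · rw [indicator_of_notMem hx]
          refine (congrArg _ (eq_empty_iff_forall_notMem.2 fun u hu => hx ?_)).trans measure_empty
          exact hu.2
    _ = _ := by
        rw [lintegral_map (Measurable.indicator (by
          exact (measurable_exitProb hr hψ.measurable).comp hcomp) hPE) h.measurable_points, ← lintegral_indicator
          (measurableSet_pointsExactlyAt h.poisson.measurable hB σ)]
        rfl

/-- Summing over orderings counts the event `n!` times and integrates `exitProb` against
`orderedPoints`, a multiple of Lebesgue measure on `B ^ n`; dividing by `n!` leaves the Poisson
weight. -/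
theorem IsIndependentEdgeMarking.measure_connectsOutside_inter_pointCount
    [IsProbabilityMeasure P] (hd : 1 ≤ d) (h : IsIndependentEdgeMarking l P X U)
    (hr : MeasurableSet {p : EuclideanSpace ℝ (Fin d) × EuclideanSpace ℝ (Fin d) | r p.1 p.2})
    (hψ : IsConnectionFunction ψ) (ht : 0 ≤ t) (n : ℕ) :
    P (connectsOutside r ψ X U t ∩ {ω | pointCount X (centeredBox d (t + 2)) ω = n}) =
      meanExitProb r ψ t n *
        poissonMeasure (ENNReal.ofReal l * volume (centeredBox d (t + 2))).toNNReal {n} := by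
  have hB : MeasurableSet (centeredBox d (t + 2)) := (isClosed_centeredBox d (t + 2)).measurableSet
  have hB' := volume_centeredBox_ne_top d (t + 2)
  have hX := h.poisson.measurable
  have hA := h.measurableSet_connectsOutside hr hψ.measurable t
  have hne : ENNReal.ofReal l * volume (centeredBox d (t + 2)) ≠ ∞ :=
    ENNReal.mul_ne_top ENNReal.ofReal_ne_top hB'
  have h1 : (n.factorial : ℝ≥0∞) *
      P (connectsOutside r ψ X U t ∩ {ω | pointCount X (centeredBox d (t + 2)) ω = n}) =
      ∑' σ : Fin n ↪ ℕ, P (connectsOutside r ψ X U t ∩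
        pointsExactlyAt X (centeredBox d (t + 2)) σ) := by
    calc _ = ∫⁻ ω in connectsOutside r ψ X U t,
          {ω | pointCount X (centeredBox d (t + 2)) ω = n}.indicator
            (fun _ => (n.factorial : ℝ≥0∞)) ω ∂P := by
          rw [lintegral_indicator_const (measurableSet_pointCount_eq hX hB n),
            Measure.restrict_apply (measurableSet_pointCount_eq hX hB n), inter_comm]
      _ = ∫⁻ ω in connectsOutside r ψ X U t, ∑' σ : Fin n ↪ ℕ,
          (pointsExactlyAt X (centeredBox d (t + 2)) σ).indicator (1 : Ω → ℝ≥0∞) ω ∂P :=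
          lintegral_congr fun ω => (tsum_indicator_pointsExactlyAt X ω).symm
      _ = _ := by
          rw [lintegral_tsum fun σ => (measurable_one.indicator
            (measurableSet_pointsExactlyAt hX hB σ)).aemeasurable]
          refine tsum_congr fun σ => ?_
          rw [lintegral_indicator_one (measurableSet_pointsExactlyAt hX hB σ),
            Measure.restrict_apply (measurableSet_pointsExactlyAt hX hB σ), inter_comm]
  have h2 : ∑' σ : Fin n ↪ ℕ, P (connectsOutside r ψ X U t ∩
        pointsExactlyAt X (centeredBox d (t + 2)) σ) =
      ∫⁻ y, exitProb r ψ t y ∂(orderedPoints X P (centeredBox d (t + 2)) n) := by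
    rw [orderedPoints, lintegral_sum_measure]
    refine tsum_congr fun σ => ?_
    rw [h.measure_connectsOutside_inter_pointsExactlyAt hr hψ ht,
      lintegral_map (measurable_exitProb hr hψ.measurable)
        (measurable_pi_lambda _ fun k => hX (σ k))]
  have hfac : (n.factorial : ℝ≥0∞) ≠ 0 := by exact_mod_cast n.factorial_ne_zero
  have hfac' : (n.factorial : ℝ≥0∞) * ENNReal.ofReal
      ((ENNReal.ofReal l * volume (centeredBox d (t + 2))).toNNReal ^ n / n.factorial) =
      (ENNReal.ofReal l * volume (centeredBox d (t + 2))) ^ n := by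
    rw [← ENNReal.ofReal_natCast, ← ENNReal.ofReal_mul (by positivity),
      mul_div_cancel₀ _ (by positivity), ENNReal.ofReal_pow (by positivity),
      ENNReal.ofReal_coe_nnreal, ENNReal.coe_toNNReal hne]
  rw [← ENNReal.mul_right_inj hfac (ENNReal.natCast_ne_top _), h1, h2,
    orderedPoints_eq hd h.poisson hB hB', lintegral_smul_measure, lintegral_pi_restrict_eq ht,
    poissonMeasure_singleton, mul_div_assoc, ENNReal.ofReal_mul (Real.exp_pos _).le, smul_eq_mul,
    mul_left_comm (n.factorial : ℝ≥0∞), mul_left_comm (n.factorial : ℝ≥0∞), hfac', mul_pow]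
  ring

theorem IsIndependentEdgeMarking.measure_connectsOutside
    [IsProbabilityMeasure P] (hd : 1 ≤ d) (h : IsIndependentEdgeMarking l P X U)
    (hr : MeasurableSet {p : EuclideanSpace ℝ (Fin d) × EuclideanSpace ℝ (Fin d) | r p.1 p.2})
    (hψ : IsConnectionFunction ψ) (ht : 0 ≤ t) :
    P (connectsOutside r ψ X U t) = ∫⁻ n, meanExitProb r ψ t n
      ∂(poissonMeasure (ENNReal.ofReal l * volume (centeredBox d (t + 2))).toNNReal) := by
  have hB : MeasurableSet (centeredBox d (t + 2)) := (isClosed_centeredBox d (t + 2)).measurableSet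
  have hB' := volume_centeredBox_ne_top d (t + 2)
  have hX := h.poisson.measurable
  have hA := h.measurableSet_connectsOutside hr hψ.measurable t
  rw [lintegral_countable']
  simp_rw [← h.measure_connectsOutside_inter_pointCount hd hr hψ ht]
  rw [← measure_iUnion (fun m n hmn => disjoint_left.2 fun ω h1 h2 => hmn
      (Nat.cast_injective (R := ℕ∞) (h1.2.symm.trans h2.2)))
    fun n => hA.inter (measurableSet_pointCount_eq hX hB n)]
  refine measure_congr ?_
  filter_upwards [h.poisson.ae_pointCount_ne_top hB hB'] with ω hω
  obtain ⟨n, hn⟩ := ENat.ne_top_iff_exists.1 hω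
  refine propext ⟨fun hm => mem_iUnion.2 ⟨n, hm, hn.symm⟩, fun hm => ?_⟩
  obtain ⟨_, hm, _⟩ := mem_iUnion.1 hm
  exact hm

theorem IsIndependentEdgeMarking.measure_percolationEvent [IsProbabilityMeasure P]
    (h : IsIndependentEdgeMarking l P X U)
    (hr : MeasurableSet {p : EuclideanSpace ℝ (Fin d) × EuclideanSpace ℝ (Fin d) | r p.1 p.2})
    (hψ : IsConnectionFunction ψ) :
    P (percolationEvent r ψ X U) = ⨅ n : ℕ, P (connectsOutside r ψ X U (n + 1)) := by
  have hanti : Antitone fun n : ℕ => connectsOutside r ψ X U (n + 1) := fun m n hmn ω hω => by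
    dsimp only at hω ⊢
    rw [connectsOutside_eq] at hω ⊢
    exact Exits.anti (by simpa using hmn) hω
  have : percolationEvent r ψ X U = ⋂ n : ℕ, connectsOutside r ψ X U (n + 1) := by
    ext ω
    simp only [percolationEvent, mem_iInter]
    refine ⟨fun hω n => hω _ (by positivity), fun hω t _ => ?_⟩
    obtain ⟨n, hn⟩ := exists_nat_ge t
    have := hω n
    rw [connectsOutside_eq] at this ⊢
    exact Exits.anti (by linarith) this
  rw [this, hanti.measure_iInter
    (fun n => (h.measurableSet_connectsOutside hr hψ.measurable _).nullMeasurableSet)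
    ⟨0, measure_ne_top _ _⟩]

end

/-! ### Right-continuity of the percolation probability. -/

theorem theorem4p1 {d : ℕ} (hd : 1 ≤ d)
    (r : EuclideanSpace ℝ (Fin d) → EuclideanSpace ℝ (Fin d) → Prop)
    (hr : IsStrictTotalOrder (EuclideanSpace ℝ (Fin d)) r)
    (hr_meas : MeasurableSet
      {p : EuclideanSpace ℝ (Fin d) × EuclideanSpace ℝ (Fin d) | r p.1 p.2})
    (ψ : EuclideanSpace ℝ (Fin d) → ℝ) (hψ : IsConnectionFunction ψ)
    (Ω : ℝ → Type*) [∀ l, MeasurableSpace (Ω l)] (P : ∀ l, Measure (Ω l))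
    [∀ l, IsProbabilityMeasure (P l)]
    (X : ∀ l, ℕ → Ω l → EuclideanSpace ℝ (Fin d)) (U : ∀ l, Option ℕ → ℕ → Ω l → ℝ)
    (hXU : ∀ l, 0 < l → IsIndependentEdgeMarking l (P l) (X l) (U l)) :
    ∀ l, 0 < l →
      ContinuousWithinAt (fun l' => percolationProbability r ψ (P l') (X l') (U l')) (Ici l) l := by
  intro l hl
  refine (ENNReal.tendsto_toReal (measure_ne_top _ _)).comp ?_
  have heq : ∀ l', l ≤ l' → ∀ n : ℕ, P l' (connectsOutside r ψ (X l') (U l') (n + 1)) =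
      ∫⁻ k, meanExitProb r ψ (n + 1) k ∂(poissonMeasure
        (ENNReal.ofReal l' * volume (centeredBox d (n + 1 + 2))).toNNReal) := fun l' hl' n =>
    (hXU l' (hl.trans_le hl')).measure_connectsOutside hd hr_meas hψ (by positivity)
  have hrate : ∀ l', l ≤ l' → ∀ n : ℕ,
      (ENNReal.ofReal l' * volume (centeredBox d (n + 1 + 2))).toNNReal =
        (ENNReal.ofReal l * volume (centeredBox d (n + 1 + 2))).toNNReal +
        (ENNReal.ofReal (l' - l) * volume (centeredBox d (n + 1 + 2))).toNNReal := fun l' hl' n => by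
    have hB' := volume_centeredBox_ne_top d ((n : ℝ) + 1 + 2)
    rw [← ENNReal.toNNReal_add (ENNReal.mul_ne_top ENNReal.ofReal_ne_top hB')
      (ENNReal.mul_ne_top ENNReal.ofReal_ne_top hB'), ← add_mul,
      ← ENNReal.ofReal_add hl.le (by linarith), add_sub_cancel]
  have hmono : ∀ l', l ≤ l' → P l (percolationEvent r ψ (X l) (U l)) ≤
      P l' (percolationEvent r ψ (X l') (U l')) := fun l' hl' => by
    rw [(hXU l hl).measure_percolationEvent hr_meas hψ,
      (hXU l' (hl.trans_le hl')).measure_percolationEvent hr_meas hψ]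
    refine iInf_mono fun n => ?_
    rw [heq l le_rfl, heq l' hl', hrate l' hl']
    exact lintegral_poissonMeasure_mono
      (meanExitProb_mono (by positivity) hr_meas hψ.measurable) le_self_add
  refine tendsto_order.2 ⟨fun a ha => ?_, fun a ha => ?_⟩
  · filter_upwards [self_mem_nhdsWithin] with l' hl' using ha.trans_le (hmono l' hl')
  -- A single box already brings the connection probability at `l` below `a`. For that fixed box the
  -- increase is at most `(l' - l)` times a finite volume, and its probability at `l'` dominates
  -- that of percolation.
  · rw [(hXU l hl).measure_percolationEvent hr_meas hψ, gt_iff_lt, iInf_lt_iff] at ha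
    obtain ⟨n, hn⟩ := ha
    have hB' := volume_centeredBox_ne_top d ((n : ℝ) + 1 + 2)
    have hlim : Filter.Tendsto (fun l' => P l (connectsOutside r ψ (X l) (U l) (n + 1)) +
        ENNReal.ofReal (l' - l) * volume (centeredBox d (n + 1 + 2))) (nhdsWithin l (Ici l))
        (nhds (P l (connectsOutside r ψ (X l) (U l) (n + 1)))) := by
      have h1 : Filter.Tendsto (fun l' => ENNReal.ofReal (l' - l)) (nhdsWithin l (Ici l))
          (nhds 0) := by
        have : Continuous fun l' => ENNReal.ofReal (l' - l) :=
          ENNReal.continuous_ofReal.comp (by fun_prop)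
        simpa using (this.tendsto l).mono_left nhdsWithin_le_nhds
      simpa using tendsto_const_nhds.add (ENNReal.Tendsto.mul_const h1 (Or.inr hB'))
    filter_upwards [hlim.eventually_lt_const hn, self_mem_nhdsWithin] with l' h1 hl'
    refine lt_of_le_of_lt ?_ h1
    rw [(hXU l' (hl.trans_le hl')).measure_percolationEvent hr_meas hψ]
    refine (iInf_le _ n).trans ?_
    rw [heq l' hl', hrate l' hl', heq l le_rfl]
    refine (lintegral_poissonMeasure_add_le (meanExitProb_le_one (by positivity)) _ _).trans ?_
    rw [ENNReal.coe_toNNReal (ENNReal.mul_ne_top ENNReal.ofReal_ne_top hB')]
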